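/- Let $G$ be a finite-dimensional real Lie group, $K \subset G$ a closed subgroup, and let $H = G/K$ be the space of left cosets with its standard structure: the quotient topology and the smooth structure for which the canonical projection $\pi : G \to H$ is a smooth submersion. Let $G$ act on $H$ by $\Phi_a([b]) = [ab]$ and on itself by left translations $L_a(b) = ab$. A Riemannian metric on $G$ is left-invariant if every $L_a$ is an isometry of it, and a Riemannian metric on $H$ is $G$-invariant if every $\Phi_a$ is an isometry of it. Given Riemannian metrics $\langle\cdot,\cdot\rangle_G$ on $G$ and $\langle\cdot,\cdot\rangle_H$ on $H$, the map $\pi$ is a Riemannian submersion if for every $g \in G$ the differential $d\pi_g$ restricts to a linear isometry of the horizontal subspace $\mathrm{Hor}_g = (\ker d\pi_g)^{\perp} \subset T_gG$ (orthogonal complement with respect to $\langle\cdot,\cdot\rangle_G$) onto $T_{\pi(g)}H$. All metrics are smooth. (1) If $\langle\cdot,\cdot\rangle_G$ is a left-invariant metric on $G$ and $\langle\cdot,\cdot\rangle_H$ is a metric on $H$ such that $\pi$ is a Riemannian submersion, then $\langle\cdot,\cdot\rangle_H$ is $G$-invariant. (2) Conversely, for every $G$-invariant metric $\langle\cdot,\cdot\rangle_H$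 on $H$ there exists a left-invariant metric $\langle\cdot,\cdot\rangle_G$ on $G$ such that $\pi : G \to H$ is a Riemannian submersion. -/

import Mathlib

open scoped Manifold ContDiff

noncomputable section

namespace HomSpace

section Metrics

variable {E : Type*} [NormedAddCommGroup E] [NormedSpace ℝ E]
  {F : Type*} [NormedAddCommGroup F] [NormedSpace ℝ F]

/-- A smooth Riemannian metric on the smooth manifold `M` (without boundary, modelled on `E`):
a positive definite symmetric bilinear form on each tangent space, depending smoothly on the
base point. -/
abbrev RiemMetric (E : Type*) [NormedAddCommGroup E] [NormedSpace ℝ E]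
    (M : Type*) [TopologicalSpace M] [ChartedSpace E M] [IsManifold 𝓘(ℝ, E) ∞ M] :=
  Bundle.ContMDiffRiemannianMetric 𝓘(ℝ, E) ∞ E (fun x : M => TangentSpace 𝓘(ℝ, E) x)

/-- The metric `m` on `M` is invariant under the action of the group `G`: for every `a : G` the
differential of `q ↦ a • q` preserves `m`. -/
def IsInvariant (G : Type*) [Group G]
    {M : Type*} [TopologicalSpace M] [ChartedSpace E M] [IsManifold 𝓘(ℝ, E) ∞ M]
    [MulAction G M] (m : RiemMetric E M) : Prop :=
  ∀ (a : G) (q : M) (X Y : TangentSpace 𝓘(ℝ, E) q),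
    m.inner (a • q)
        (mfderiv 𝓘(ℝ, E) 𝓘(ℝ, E) (fun p : M => a • p) q X)
        (mfderiv 𝓘(ℝ, E) 𝓘(ℝ, E) (fun p : M => a • p) q Y)
      = m.inner q X Y

/-- The metric `m` on the Lie group `G` is left-invariant: for every `a : G` the differential of
left translation by `a` preserves `m`. -/
def IsLeftInvariant
    {G : Type*} [Group G] [TopologicalSpace G] [ChartedSpace E G] [IsManifold 𝓘(ℝ, E) ∞ G]
    (m : RiemMetric E G) : Prop :=
  ∀ (a b : G) (X Y : TangentSpace 𝓘(ℝ, E) b),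
    m.inner (a * b)
        (mfderiv 𝓘(ℝ, E) 𝓘(ℝ, E) (fun c : G => a * c) b X)
        (mfderiv 𝓘(ℝ, E) 𝓘(ℝ, E) (fun c : G => a * c) b Y)
      = m.inner b X Y

variable {M : Type*} [TopologicalSpace M] [ChartedSpace E M] [IsManifold 𝓘(ℝ, E) ∞ M]
  {N : Type*} [TopologicalSpace N] [ChartedSpace F N] [IsManifold 𝓘(ℝ, F) ∞ N]

/-- The vertical subspace at `x` of a map `f : M → N`: the kernel of the differential at `x`. -/
def vertical (E F : Type*) [NormedAddCommGroup E] [NormedSpace ℝ E]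
    [NormedAddCommGroup F] [NormedSpace ℝ F]
    {M : Type*} [TopologicalSpace M] [ChartedSpace E M]
    {N : Type*} [TopologicalSpace N] [ChartedSpace F N]
    (f : M → N) (x : M) : Set (TangentSpace 𝓘(ℝ, E) x) :=
  {V | mfderiv 𝓘(ℝ, E) 𝓘(ℝ, F) f x V = 0}

/-- The horizontal subspace at `x` of a map `f : M → N`: the orthogonal complement, with respect
to the metric `m` on `M`, of the vertical subspace. -/
def horizontal (F : Type*) [NormedAddCommGroup F] [NormedSpace ℝ F]
    {N : Type*} [TopologicalSpace N] [ChartedSpace F N]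
    (m : RiemMetric E M) (f : M → N) (x : M) : Set (TangentSpace 𝓘(ℝ, E) x) :=
  {X | ∀ V ∈ vertical E F f x, m.inner x X V = 0}

/-- `f : (M, m) → (N, n)` is a Riemannian submersion: `f` is smooth and, for every `x`, its
differential restricts to a linear isometry of the horizontal subspace at `x` onto the tangent
space of `N` at `f x`. -/
structure IsRiemannianSubmersion (m : RiemMetric E M) (n : RiemMetric F N) (f : M → N) :
    Prop where
  contMDiff : ContMDiff 𝓘(ℝ, E) 𝓘(ℝ, F) ∞ f
  bijOn : ∀ x : M, Set.BijOn (mfderiv 𝓘(ℝ, E) 𝓘(ℝ, F) f x) (horizontal F m f x) Set.univ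
  isometry : ∀ x : M, ∀ X ∈ horizontal F m f x, ∀ Y ∈ horizontal F m f x,
    n.inner (f x) (mfderiv 𝓘(ℝ, E) 𝓘(ℝ, F) f x X) (mfderiv 𝓘(ℝ, E) 𝓘(ℝ, F) f x Y)
      = m.inner x X Y

end Metrics

end HomSpace

end

/-!
Left translation by `a` on `G` covers the action of `a` on `G ⧸ K`: differentiating
`[a * b] = a • [b]` gives `dπ ∘ dL_a = dΦ_a ∘ dπ` (`mfderiv_mk_mul_left`). The action has to be
known to be differentiable for this, which follows from the local sections of the submersion `π`
(`exists_contMDiffAt_section`). Since the differentials `dL_a` and `dΦ_a` are invertible, `dL_a`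
maps vertical vectors onto vertical vectors, and when the metric on `G` is left-invariant it also
maps horizontal vectors to horizontal vectors.

If `π` is a Riemannian submersion from a left-invariant metric, the inner product of two tangent
vectors of `G ⧸ K` is that of their horizontal lifts, and moving them by `dΦ_a` moves the lifts by
`dL_a`. Hence the metric on `G ⧸ K` is invariant.

Conversely, given an invariant metric `h` on `G ⧸ K`, it suffices to choose the inner product at `1`
and to spread it by left translations. At `1` one takes
`B(v, w) = h(dπ v, dπ w) + Q(P v, P w)`, where `P` is any linear projection onto the kernel of `dπ`
and `Q` any inner product. The orthogonal complement of `ker dπ` for `B` is `ker P`, on which `B` is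
the pullback of `h` (`exists_inner_isometry_on_orthogonal`). No invariance of `B` under `K` is
required: the differential of `π` at `g` is that at `1` up to `dL_{g⁻¹}` and `dΦ_{g⁻¹}`, and both
are isometries, the second one because `h` is invariant. Smoothness of the metric on `G` is that of the
Maurer–Cartan form `g ↦ dL_{g⁻¹}` (`contMDiff_leftInvariantForm`).
-/

noncomputable section

namespace HomSpace

open Topology Filter Bornology

/-! ### Submersions -/

section Submersion

variable {E : Type*} [NormedAddCommGroup E] [NormedSpace ℝ E]
  {F : Type*} [NormedAddCommGroup F] [NormedSpace ℝ F]
  {M : Type*} [TopologicalSpace M] [ChartedSpace E M]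
  {N : Type*} [TopologicalSpace N] [ChartedSpace F N]

/-- A submersion has a local section through every point `x`: in the charts of its normal form
`(u, c) ↦ u`, freeze `c` at the value it takes at `x`. -/
theorem exists_contMDiffAt_section {n : WithTop ℕ∞} {f : M → N}
    (hf : Manifold.IsSubmersion 𝓘(ℝ, E) 𝓘(ℝ, F) n f) (x : M) :
    ∃ s : N → M, s (f x) = x ∧ ContMDiffAt 𝓘(ℝ, F) 𝓘(ℝ, E) n s (f x) ∧
      ∀ᶠ y in 𝓝 (f x), f (s y) = y := by
  obtain ⟨C, _, _, h⟩ := hf.isSubmersionAt x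
  set φ := h.domChart
  set ψ := h.codChart
  have hxφ : x ∈ φ.source := h.mem_domChart_source
  have hxψ : f x ∈ ψ.source := h.mem_codChart_source
  have hloc : ∀ z ∈ φ.target, ψ (f (φ.symm z)) = (h.equiv z).1 := fun z hz => by
    have hz' : z ∈ (h.domChart.extend 𝓘(ℝ, E)).target := by simpa [φ] using hz
    simpa using h.writtenInCharts hz'
  let c : C := (h.equiv (φ x)).2
  have hψx : ψ (f x) = (h.equiv (φ x)).1 := by
    simpa [φ.left_inv hxφ] using hloc (φ x) (φ.map_source hxφ)
  let t : N → E := fun y => h.equiv.symm (ψ y, c)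
  have htx : t (f x) = φ x := by simp [t, c, hψx]
  have hψ : ContMDiffAt 𝓘(ℝ, F) 𝓘(ℝ, F) n ψ (f x) :=
    contMDiffAt_of_mem_maximalAtlas h.codChart_mem_maximalAtlas hxψ
  have ht : ContMDiffAt 𝓘(ℝ, F) 𝓘(ℝ, E) n t (f x) :=
    h.equiv.symm.contDiff.contMDiff.contMDiffAt.comp (f x) (hψ.prodMk_space contMDiffAt_const)
  refine ⟨fun y => φ.symm (t y), by simp [htx, φ.left_inv hxφ], ?_, ?_⟩
  · refine ContMDiffAt.comp (f x) (contMDiffAt_symm_of_mem_maximalAtlas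
      h.domChart_mem_maximalAtlas ?_) ht
    rw [htx]; exact φ.map_source hxφ
  · have h1 : ∀ᶠ y in 𝓝 (f x), t y ∈ φ.target := ht.continuousAt.eventually_mem
      (φ.open_target.mem_nhds (by rw [htx]; exact φ.map_source hxφ))
    filter_upwards [h1, ψ.open_source.mem_nhds hxψ] with y hy hyψ
    refine ψ.injOn (h.source_subset_preimage_source (φ.map_target hy)) hyψ ?_
    rw [hloc _ hy]
    simp [t]

/-- The differential of a local section through `x` is a right inverse. -/
theorem mfderiv_surjective_of_isSubmersion {n : WithTop ℕ∞} (hn : n ≠ 0) {f : M → N}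
    (hf : Manifold.IsSubmersion 𝓘(ℝ, E) 𝓘(ℝ, F) n f) (x : M) :
    Function.Surjective (mfderiv 𝓘(ℝ, E) 𝓘(ℝ, F) f x) := by
  obtain ⟨s, hsx, hs, hfs⟩ := exists_contMDiffAt_section hf x
  have hd : HasMFDerivAt 𝓘(ℝ, F) 𝓘(ℝ, F) (f ∘ s) (f x)
      ((mfderiv 𝓘(ℝ, E) 𝓘(ℝ, F) f (s (f x))).comp (mfderiv 𝓘(ℝ, F) 𝓘(ℝ, E) s (f x))) :=
    HasMFDerivAt.comp (f x)
      ((hf.contMDiff.mdifferentiable hn) (s (f x))).hasMFDerivAt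
      (hs.mdifferentiableAt hn).hasMFDerivAt
  have hid := (hasMFDerivAt_id (I := 𝓘(ℝ, F)) (f x)).congr_of_eventuallyEq
    (f₁ := f ∘ s) hfs
  have heq := hasMFDerivAt_unique hd hid
  rw [hsx] at heq
  intro v
  exact ⟨mfderiv 𝓘(ℝ, F) 𝓘(ℝ, E) s (f x) v, DFunLike.congr_fun heq v⟩

/-- Smoothness descends along a surjective submersion: near each point `g` is `(g ∘ f) ∘ s` for a
local section `s` of `f`. -/
theorem contMDiff_of_comp_isSubmersion {n : WithTop ℕ∞}
    {E' : Type*} [NormedAddCommGroup E'] [NormedSpace ℝ E']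
    {P : Type*} [TopologicalSpace P] [ChartedSpace E' P]
    {f : M → N} (hf : Manifold.IsSubmersion 𝓘(ℝ, E) 𝓘(ℝ, F) n f) (hsurj : Function.Surjective f)
    {g : N → P} (hg : ContMDiff 𝓘(ℝ, E) 𝓘(ℝ, E') n (g ∘ f)) :
    ContMDiff 𝓘(ℝ, F) 𝓘(ℝ, E') n g := by
  intro y
  obtain ⟨x, rfl⟩ := hsurj y
  obtain ⟨s, -, hs, hfs⟩ := exists_contMDiffAt_section hf x
  refine ((hg (s (f x))).comp (f x) hs).congr_of_eventuallyEq ?_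
  filter_upwards [hfs] with y hy
  simp [hy]

end Submersion

/-! ### Inner products on a finite-dimensional space -/

section LinearAlgebra

variable {E : Type*} [NormedAddCommGroup E] [NormedSpace ℝ E] [FiniteDimensional ℝ E]
  {F : Type*} [NormedAddCommGroup F] [NormedSpace ℝ F]

/-- The form attains a positive minimum on the unit sphere, which bounds its unit ball. -/
theorem isVonNBounded_of_pos (b : E →L[ℝ] E →L[ℝ] ℝ) (hb : ∀ v, v ≠ 0 → 0 < b v v) :
    IsVonNBounded ℝ {v : E | b v v < 1} := by
  rw [NormedSpace.isVonNBounded_iff]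
  have : ProperSpace E := FiniteDimensional.proper ℝ E
  rcases (Metric.sphere (0 : E) 1).eq_empty_or_nonempty with h0 | h0
  · have : Subsingleton E := by
      by_contra hE
      rw [not_subsingleton_iff_nontrivial] at hE
      exact (NormedSpace.sphere_nonempty.2 zero_le_one).ne_empty h0
    exact (Set.subsingleton_of_subsingleton (s := {v : E | b v v < 1})).finite.isBounded
  obtain ⟨u, hu, hmin⟩ := (isCompact_sphere (0 : E) 1).exists_isMinOn h0
    (f := fun v => b v v) (by fun_prop)
  have hu0 : u ≠ 0 := by rintro rfl; simp at hu
  have hc := hb u hu0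
  refine (Metric.isBounded_closedBall (x := (0 : E)) (r := Real.sqrt (b u u)⁻¹)).subset ?_
  intro v hv
  rw [mem_closedBall_zero_iff]
  refine Real.le_sqrt_of_sq_le ?_
  rcases eq_or_ne v 0 with rfl | hv0
  · simpa using hc.le
  have hnv : 0 < ‖v‖ := norm_pos_iff.2 hv0
  have hle : b u u ≤ b (‖v‖⁻¹ • v) (‖v‖⁻¹ • v) :=
    hmin (by simp [norm_smul, hnv.ne'])
  have hv1 : b v v < 1 := hv
  simp only [map_smul, smul_apply, smul_eq_mul] at hle
  rw [← one_div, le_div_iff₀ hc]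
  calc ‖v‖ ^ 2 * b u u ≤ ‖v‖ ^ 2 * (‖v‖⁻¹ * (‖v‖⁻¹ * b v v)) := by gcongr
    _ = b v v := by field_simp
    _ ≤ 1 := hv1.le

theorem exists_clm_proj_ker (p : E →L[ℝ] F) :
    ∃ P : E →L[ℝ] E, (∀ v, p (P v) = 0) ∧ ∀ v, p v = 0 → P v = v := by
  obtain ⟨q, hq⟩ := p.ker.exists_isCompl
  let P : E →ₗ[ℝ] E := p.ker.subtype ∘ₗ p.ker.projectionOnto q hq
  refine ⟨P.toContinuousLinearMap, fun v => ?_, fun v hv => ?_⟩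
  · exact (p.ker.projectionOnto q hq v).2
  · exact congrArg Subtype.val (Submodule.projectionOnto_apply_left hq ⟨v, hv⟩)

variable (E) in
/-- The inner product of a Euclidean space, transported along a linear isomorphism. -/
theorem exists_symm_pos : ∃ Q : E →L[ℝ] E →L[ℝ] ℝ, (∀ v w, Q v w = Q w v) ∧
    ∀ v, v ≠ 0 → 0 < Q v v := by
  let e : E →L[ℝ] EuclideanSpace ℝ (Fin (Module.finrank ℝ E)) := (toEuclidean (E := E) : _ ≃L[ℝ] _)
  refine ⟨(innerSL ℝ).bilinearComp e e, fun v w => ?_, fun v hv => ?_⟩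
  · simp only [ContinuousLinearMap.bilinearComp_apply, innerSL_apply_apply]
    exact real_inner_comm _ _
  · simp only [ContinuousLinearMap.bilinearComp_apply, innerSL_apply_apply]
    exact real_inner_self_pos.2 (by simpa [e] using hv)

/-- An inner product on the target of a surjective linear map `p` comes from one on the source, in
the sense that `p` maps the orthogonal complement of its kernel isometrically onto the target. The
form is `B v w = b (p v) (p w) + Q (P v) (P w)`, with `P` a projection onto the kernel and `Q` any
inner product. -/
theorem exists_inner_isometry_on_orthogonal (p : E →L[ℝ] F) (hp : Function.Surjective p)
    (b : F →L[ℝ] F →L[ℝ] ℝ) (hs : ∀ v w, b v w = b w v) (hb : ∀ v, v ≠ 0 → 0 < b v v) :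
    ∃ B : E →L[ℝ] E →L[ℝ] ℝ, (∀ v w, B v w = B w v) ∧ (∀ v, v ≠ 0 → 0 < B v v) ∧
      Set.BijOn p {v | ∀ w, p w = 0 → B v w = 0} Set.univ ∧
      ∀ v, (∀ w, p w = 0 → B v w = 0) → ∀ w, (∀ u, p u = 0 → B w u = 0) →
        b (p v) (p w) = B v w := by
  obtain ⟨P, hP0, hP1⟩ := exists_clm_proj_ker p
  obtain ⟨Q, hQs, hQp⟩ := exists_symm_pos E
  have hb' : ∀ v, 0 ≤ b v v := fun v => by
    rcases eq_or_ne v 0 with rfl | h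
    · simp
    · exact (hb v h).le
  have hQ' : ∀ v, 0 ≤ Q v v := fun v => by
    rcases eq_or_ne v 0 with rfl | h
    · simp
    · exact (hQp v h).le
  let B : E →L[ℝ] E →L[ℝ] ℝ := b.bilinearComp p p + Q.bilinearComp P P
  have hB : ∀ v w, B v w = b (p v) (p w) + Q (P v) (P w) := fun v w => rfl
  -- Testing `B v` against the vertical vector `P v` shows that the complement lies in `ker P`.
  have hhor : ∀ v, (∀ w, p w = 0 → B v w = 0) → P v = 0 := fun v hv => by
    by_contra h
    have h1 := hv (P v) (hP0 v)
    rw [hB, hP0, map_zero, zero_add, hP1 _ (hP0 v)] at h1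
    exact (hQp _ h).ne' h1
  refine ⟨B, fun v w => ?_, fun v hv => ?_, ⟨fun _ _ => trivial, ?_, ?_⟩, ?_⟩
  · rw [hB, hB, hs, hQs]
  · rw [hB]
    by_cases h : p v = 0
    · rw [hP1 v h]
      exact add_pos_of_nonneg_of_pos (hb' _) (hQp v hv)
    · exact add_pos_of_pos_of_nonneg (hb _ h) (hQ' _)
  · intro v hv w hw hvw
    have h1 : p (v - w) = 0 := by rw [map_sub, hvw, sub_self]
    have h2 := hP1 _ h1
    rw [map_sub, hhor v hv, hhor w hw, sub_self] at h2
    exact sub_eq_zero.1 h2.symm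
  · intro y _
    obtain ⟨x, rfl⟩ := hp y
    refine ⟨x - P x, fun w hw => ?_, by rw [map_sub, hP0, sub_zero]⟩
    rw [hB, hw, map_sub P, hP1 _ (hP0 x)]
    simp
  · intro v hv w _
    rw [hB, hhor v hv]
    simp

end LinearAlgebra

/-! ### Left translations -/

section Translations

variable {E : Type*} [NormedAddCommGroup E] [NormedSpace ℝ E]
  {G : Type*} [Group G] [TopologicalSpace G] [ChartedSpace E G]

/-- Stated for `u` with a proof of `u = 1`, so that it applies to products such as `a * a⁻¹` without
rewriting inside the type of a tangent vector. -/
theorem mfderiv_mul_left_of_eq_one {u : G} (hu : u = 1) (b : G) (X : E) :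
    (mfderiv 𝓘(ℝ, E) 𝓘(ℝ, E) (fun x : G => u * x) b : E →L[ℝ] E) X = X := by
  subst hu
  have h : (fun x : G => 1 * x) = id := by ext x; simp
  rw [h]
  exact congrArg (fun T : E →L[ℝ] E => T X) (mfderiv_id (I := 𝓘(ℝ, E)) (x := b))

variable [LieGroup 𝓘(ℝ, E) ∞ G]

theorem mdifferentiable_mul_left (a : G) :
    MDifferentiable 𝓘(ℝ, E) 𝓘(ℝ, E) (fun c : G => a * c) :=
  (contMDiff_mul_left (n := ∞)).mdifferentiable (by simp)

/-- The chain rule for `L_a ∘ L_b = L_{ab}`. -/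
theorem mfderiv_mul_left_mul (a b c : G) (X : TangentSpace 𝓘(ℝ, E) c) :
    mfderiv 𝓘(ℝ, E) 𝓘(ℝ, E) (fun x : G => a * x) (b * c)
      (mfderiv 𝓘(ℝ, E) 𝓘(ℝ, E) (fun x : G => b * x) c X) =
    mfderiv 𝓘(ℝ, E) 𝓘(ℝ, E) (fun x : G => a * b * x) c X := by
  have h : (fun x : G => a * b * x) = (fun x => a * x) ∘ (fun x => b * x) := by
    ext x; simp [mul_assoc]
  rw [h, mfderiv_comp c (mdifferentiable_mul_left a (b * c)) (mdifferentiable_mul_left b c)]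
  rfl

theorem mfderiv_mul_left_surjective (a b : G) :
    Function.Surjective (mfderiv 𝓘(ℝ, E) 𝓘(ℝ, E) (fun x : G => a * x) b) := by
  obtain ⟨c, rfl⟩ : ∃ c, b = a⁻¹ * c := ⟨a * b, by simp⟩
  intro W
  have h := mfderiv_mul_left_mul a a⁻¹ c (show TangentSpace 𝓘(ℝ, E) c from W)
  exact ⟨mfderiv 𝓘(ℝ, E) 𝓘(ℝ, E) (fun x : G => a⁻¹ * x) c W,
    h.trans (mfderiv_mul_left_of_eq_one (E := E) (mul_inv_cancel a) c W)⟩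

theorem mfderiv_mul_left_injective (a b : G) :
    Function.Injective (mfderiv 𝓘(ℝ, E) 𝓘(ℝ, E) (fun x : G => a * x) b) := by
  refine Function.LeftInverse.injective
    (g := mfderiv 𝓘(ℝ, E) 𝓘(ℝ, E) (fun x : G => a⁻¹ * x) (a * b)) fun X => ?_
  exact (mfderiv_mul_left_mul a⁻¹ a b X).trans
    (mfderiv_mul_left_of_eq_one (E := E) (inv_mul_cancel a) b X)

end Translations

/-! ### The Maurer–Cartan form and left-invariant bilinear forms -/

section BilinearForms

variable {E : Type*} [NormedAddCommGroup E] [NormedSpace ℝ E]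
  {G : Type*} [Group G] [TopologicalSpace G] [ChartedSpace E G]

variable (E) in
/-- The left Maurer–Cartan form of `G`: at `g` it is the differential of left translation by `g⁻¹`,
which carries the tangent space at `g` to the tangent space at `1`. All tangent spaces of `G` are
by definition copies of the model space `E`, so it is recorded as an endomorphism of `E`; this
avoids the dependence of its target on the expression `g⁻¹ * g`. -/
def maurerCartan (g : G) : E →L[ℝ] E :=
  mfderiv 𝓘(ℝ, E) 𝓘(ℝ, E) (fun x : G => g⁻¹ * x) g

/-- The left-invariant field of bilinear forms on `G` whose value at `1` is `B`. -/
def leftInvariantForm (B : E →L[ℝ] E →L[ℝ] ℝ) (g : G) :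
    TangentSpace 𝓘(ℝ, E) g →L[ℝ] TangentSpace 𝓘(ℝ, E) g →L[ℝ] ℝ :=
  (B.bilinearComp (maurerCartan E g) (maurerCartan E g) : E →L[ℝ] E →L[ℝ] ℝ)

theorem leftInvariantForm_apply (B : E →L[ℝ] E →L[ℝ] ℝ) (g : G) (X Y : TangentSpace 𝓘(ℝ, E) g) :
    leftInvariantForm B g X Y = B (maurerCartan E g X) (maurerCartan E g Y) :=
  rfl

variable [LieGroup 𝓘(ℝ, E) ∞ G]

/-- The Maurer–Cartan form is left-invariant. -/
theorem maurerCartan_mul_left (a b : G) (X : TangentSpace 𝓘(ℝ, E) b) :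
    maurerCartan E (a * b) (mfderiv 𝓘(ℝ, E) 𝓘(ℝ, E) (fun x : G => a * x) b X) =
      maurerCartan E b X := by
  refine (mfderiv_mul_left_mul (a * b)⁻¹ a b X).trans ?_
  have h : (a * b)⁻¹ * a = b⁻¹ := by group
  rw [h]
  rfl

/-- In the trivialization of the tangent bundle at `g₀`, the form is the composition of `B` with the
coordinate expression of the Maurer–Cartan form, which is a partial derivative of the smooth map
`(g, x) ↦ g⁻¹ * x`. -/
theorem contMDiff_leftInvariantForm (B : E →L[ℝ] E →L[ℝ] ℝ) :
    ContMDiff 𝓘(ℝ, E) (𝓘(ℝ, E).prod 𝓘(ℝ, E →L[ℝ] E →L[ℝ] ℝ)) ∞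
      (fun g : G => Bundle.TotalSpace.mk' (E →L[ℝ] E →L[ℝ] ℝ)
        (E := fun x : G => TangentSpace 𝓘(ℝ, E) x →L[ℝ] TangentSpace 𝓘(ℝ, E) x →L[ℝ] ℝ) g
        (leftInvariantForm B g)) := by
  intro g₀
  rw [Bundle.contMDiffAt_section]
  have hmul : ContMDiffAt (𝓘(ℝ, E).prod 𝓘(ℝ, E)) 𝓘(ℝ, E) ∞
      (Function.uncurry fun (g x : G) => g⁻¹ * x) (g₀, g₀) :=
    (contMDiff_fst.inv.mul contMDiff_snd).contMDiffAt
  have h1 := ContMDiffAt.mfderiv (m := ∞) (fun (g x : G) => g⁻¹ * x) id hmul contMDiffAt_id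
    (by simp)
  -- `Θ` is the Maurer–Cartan form read in the tangent coordinates at `g₀`.
  set Θ := inTangentCoordinates 𝓘(ℝ, E) 𝓘(ℝ, E) id (fun x : G => x⁻¹ * id x)
    (fun x => mfderiv 𝓘(ℝ, E) 𝓘(ℝ, E) (fun y => x⁻¹ * y) (id x)) g₀ with hΘ
  have h2 : ContMDiffAt 𝓘(ℝ, E) 𝓘(ℝ, E →L[ℝ] E →L[ℝ] ℝ) ∞
      (fun g => ((ContinuousLinearMap.compL ℝ E E ℝ).flip (Θ g)).comp (B.comp (Θ g))) g₀ :=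
    ((ContinuousLinearMap.compL ℝ E E ℝ).flip.contDiff.contMDiff.contMDiffAt.comp g₀ h1).clm_comp
      (contMDiffAt_const.clm_comp h1)
  refine h2.congr_of_eventuallyEq ?_
  filter_upwards [(chartAt E g₀).open_source.mem_nhds (mem_chart_source E g₀)] with g hg
  have hΘg : ∀ v : E, Θ g v =
      maurerCartan E g ((trivializationAt E (TangentSpace 𝓘(ℝ, E)) g₀).symm g v : E) := by
    intro v
    have hy : g⁻¹ * id g ∈ (chartAt E (g₀⁻¹ * id g₀)).source := by simp
    rw [hΘ, inTangentCoordinates_eq (I := 𝓘(ℝ, E)) (I' := 𝓘(ℝ, E)) (id : G → G)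
      (fun x : G => x⁻¹ * id x)
      (fun x => mfderiv 𝓘(ℝ, E) 𝓘(ℝ, E) (fun y => x⁻¹ * y) (id x)) (x₀ := g₀) (x := g) hg hy]
    have h3 := DFunLike.congr_fun
      (TangentBundle.symmL_trivializationAt_eq_core (I := 𝓘(ℝ, E)) hg) v
    rw [Bundle.Trivialization.symmL_apply _ (by simpa using hg)] at h3
    rw [h3]
    -- In the target the coordinates never change, as `g⁻¹ * g` is always the identity.
    have h4 : ∀ p q : G, p = 1 → q = 1 → ∀ w : E,
        (tangentBundleCore 𝓘(ℝ, E) G).coordChange (achart E p) (achart E q) p w = w := by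
      rintro _ _ rfl rfl w
      exact (tangentBundleCore 𝓘(ℝ, E) G).coordChange_self _ _ (mem_chart_source E (1 : G)) w
    exact h4 _ _ (by simp) (by simp) _
  ext v w
  rw [hom_trivializationAt_apply]
  simp only
  rw [inCoordinates_apply_eq₂ (F₃ := ℝ) (E₃ := fun _ : G => ℝ)]
  · simp [leftInvariantForm_apply, hΘg]
  · simpa using hg
  · simpa using hg
  · simp

end BilinearForms

/-! ### The action on the quotient -/

section Quotient

variable {E : Type*} [NormedAddCommGroup E] [NormedSpace ℝ E]
  {F : Type*} [NormedAddCommGroup F] [NormedSpace ℝ F]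
  {G : Type*} [Group G] [TopologicalSpace G] [ChartedSpace E G] [LieGroup 𝓘(ℝ, E) ∞ G]
  {K : Subgroup G} [ChartedSpace F (G ⧸ K)]

theorem contMDiff_smul_quotient
    (hπ : Manifold.IsSubmersion 𝓘(ℝ, E) 𝓘(ℝ, F) ∞ (QuotientGroup.mk : G → G ⧸ K)) (a : G) :
    ContMDiff 𝓘(ℝ, F) 𝓘(ℝ, F) ∞ (fun p : G ⧸ K => a • p) :=
  contMDiff_of_comp_isSubmersion hπ Quotient.mk_surjective
    (hπ.contMDiff.comp (contMDiff_mul_left (a := a)))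

/-- The differential of `[a * b] = a • [b]`: the projection intertwines left translation by `a` with
the action of `a`. -/
theorem mfderiv_mk_mul_left
    (hπ : Manifold.IsSubmersion 𝓘(ℝ, E) 𝓘(ℝ, F) ∞ (QuotientGroup.mk : G → G ⧸ K)) (a b : G)
    (X : TangentSpace 𝓘(ℝ, E) b) :
    mfderiv 𝓘(ℝ, E) 𝓘(ℝ, F) (QuotientGroup.mk : G → G ⧸ K) (a * b)
        (mfderiv 𝓘(ℝ, E) 𝓘(ℝ, E) (fun x : G => a * x) b X) =
      mfderiv 𝓘(ℝ, F) 𝓘(ℝ, F) (fun p : G ⧸ K => a • p) (QuotientGroup.mk b)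
        (mfderiv 𝓘(ℝ, E) 𝓘(ℝ, F) (QuotientGroup.mk : G → G ⧸ K) b X) := by
  have hd := hπ.contMDiff.mdifferentiable (by simp)
  have h1 := mfderiv_comp b (hd (a * b)) (mdifferentiable_mul_left a b)
  have h2 := mfderiv_comp b ((contMDiff_smul_quotient hπ a).mdifferentiable (by simp)
    (QuotientGroup.mk b)) (hd b)
  exact (congrArg (fun T : E →L[ℝ] F => T X) h1).symm.trans
    (congrArg (fun T : E →L[ℝ] F => T X) h2)

theorem mfderiv_smul_injective
    (hπ : Manifold.IsSubmersion 𝓘(ℝ, E) 𝓘(ℝ, F) ∞ (QuotientGroup.mk : G → G ⧸ K)) (a : G)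
    (q : G ⧸ K) :
    Function.Injective (mfderiv 𝓘(ℝ, F) 𝓘(ℝ, F) (fun p : G ⧸ K => a • p) q) := by
  have hd := fun c : G => (contMDiff_smul_quotient hπ c).mdifferentiable (by simp)
  have h := mfderiv_comp q (hd a⁻¹ (a • q)) (hd a q)
  have hid : (fun p : G ⧸ K => a⁻¹ • p) ∘ (fun p => a • p) = id := by ext p; simp
  rw [hid, mfderiv_id] at h
  exact Function.LeftInverse.injective
    (g := mfderiv 𝓘(ℝ, F) 𝓘(ℝ, F) (fun p : G ⧸ K => a⁻¹ • p) (a • q))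
    fun X => (congrArg (fun T : F →L[ℝ] F => T X) h).symm

/-- The differential of the projection at `1` determines it at every `g`. -/
theorem mfderiv_mk_one_maurerCartan
    (hπ : Manifold.IsSubmersion 𝓘(ℝ, E) 𝓘(ℝ, F) ∞ (QuotientGroup.mk : G → G ⧸ K)) (g : G)
    (X : TangentSpace 𝓘(ℝ, E) g) :
    mfderiv 𝓘(ℝ, E) 𝓘(ℝ, F) (QuotientGroup.mk : G → G ⧸ K) 1 (maurerCartan E g X) =
      mfderiv 𝓘(ℝ, F) 𝓘(ℝ, F) (fun p : G ⧸ K => g⁻¹ • p) (QuotientGroup.mk g)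
        (mfderiv 𝓘(ℝ, E) 𝓘(ℝ, F) (QuotientGroup.mk : G → G ⧸ K) g X) := by
  have h : ∀ x : G, x = 1 →
      (mfderiv 𝓘(ℝ, E) 𝓘(ℝ, F) (QuotientGroup.mk : G → G ⧸ K) x : E →L[ℝ] F) =
        mfderiv 𝓘(ℝ, E) 𝓘(ℝ, F) (QuotientGroup.mk : G → G ⧸ K) 1 := by rintro _ rfl; rfl
  exact (congrArg (fun T : E →L[ℝ] F => T (maurerCartan E g X)) (h _ (inv_mul_cancel g))).symm.trans
    (mfderiv_mk_mul_left hπ g⁻¹ g X)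

/-- Left translations are isometries and permute the vertical subspaces, hence they permute the
horizontal subspaces. -/
theorem mul_left_mem_horizontal
    (hπ : Manifold.IsSubmersion 𝓘(ℝ, E) 𝓘(ℝ, F) ∞ (QuotientGroup.mk : G → G ⧸ K))
    {m : RiemMetric E G} (hm : IsLeftInvariant m) (a b : G) {X : TangentSpace 𝓘(ℝ, E) b}
    (hX : X ∈ horizontal F m (QuotientGroup.mk : G → G ⧸ K) b) :
    mfderiv 𝓘(ℝ, E) 𝓘(ℝ, E) (fun x : G => a * x) b X ∈
      horizontal F m (QuotientGroup.mk : G → G ⧸ K) (a * b) := by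
  intro W hW
  obtain ⟨V, rfl⟩ := mfderiv_mul_left_surjective a b W
  rw [hm a b X V]
  refine hX V (mfderiv_smul_injective hπ a (QuotientGroup.mk b) ?_)
  rw [map_zero]
  exact (mfderiv_mk_mul_left hπ a b V).symm.trans hW

variable [IsManifold 𝓘(ℝ, F) ∞ (G ⧸ K)]

/-- Two tangent vectors of `G ⧸ K` at `[b]` lift to horizontal vectors at `b`. Left translation by
`a` keeps the lifts horizontal and covers the action of `a`, so the differential of the action
preserves the inner product because that of the translation does. -/
theorem isInvariant_of_isRiemannianSubmersion
    (hπ : Manifold.IsSubmersion 𝓘(ℝ, E) 𝓘(ℝ, F) ∞ (QuotientGroup.mk : G → G ⧸ K))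
    {mG : RiemMetric E G} {mH : RiemMetric F (G ⧸ K)} (hm : IsLeftInvariant mG)
    (hsub : IsRiemannianSubmersion mG mH (QuotientGroup.mk : G → G ⧸ K)) :
    IsInvariant G mH := by
  intro a q X Y
  obtain ⟨b, rfl⟩ := Quotient.mk_surjective q
  obtain ⟨X', hX', rfl⟩ := (hsub.bijOn b).surjOn (Set.mem_univ X)
  obtain ⟨Y', hY', rfl⟩ := (hsub.bijOn b).surjOn (Set.mem_univ Y)
  have h := hsub.isometry (a * b) _ (mul_left_mem_horizontal hπ hm a b hX')
    _ (mul_left_mem_horizontal hπ hm a b hY')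
  rw [mfderiv_mk_mul_left hπ, mfderiv_mk_mul_left hπ, hm] at h
  exact h.trans (hsub.isometry b X' hX' Y' hY').symm

end Quotient

/-! ### Left-invariant metrics -/

section Existence

variable {E : Type*} [NormedAddCommGroup E] [NormedSpace ℝ E] [FiniteDimensional ℝ E]
  {F : Type*} [NormedAddCommGroup F] [NormedSpace ℝ F]
  {G : Type*} [Group G] [TopologicalSpace G] [ChartedSpace E G] [LieGroup 𝓘(ℝ, E) ∞ G]

/-- The left-invariant Riemannian metric on `G` whose value at `1` is the inner product `B`. -/
def leftInvariantMetric (B : E →L[ℝ] E →L[ℝ] ℝ) (hs : ∀ v w, B v w = B w v)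
    (hB : ∀ v, v ≠ 0 → 0 < B v v) : RiemMetric E G :=
  have hpos : ∀ (g : G) (X : E), X ≠ 0 → 0 < B (maurerCartan E g X) (maurerCartan E g X) :=
    fun g _ hX => hB _ fun h => hX (mfderiv_mul_left_injective g⁻¹ g (h.trans (map_zero _).symm))
  { inner := leftInvariantForm B
    symm := fun _ _ _ => hs _ _
    pos := hpos
    isVonNBounded := fun g =>
      isVonNBounded_of_pos (B.bilinearComp (maurerCartan E g) (maurerCartan E g)) (hpos g)
    contMDiff := contMDiff_leftInvariantForm B }

theorem isLeftInvariant_leftInvariantMetric (B : E →L[ℝ] E →L[ℝ] ℝ) (hs : ∀ v w, B v w = B w v)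
    (hB : ∀ v, v ≠ 0 → 0 < B v v) :
    IsLeftInvariant (leftInvariantMetric B hs hB : RiemMetric E G) := fun a b X Y =>
  congrArg₂ (fun v w => B v w) (maurerCartan_mul_left a b X) (maurerCartan_mul_left a b Y)

variable {K : Subgroup G} [ChartedSpace F (G ⧸ K)] [IsManifold 𝓘(ℝ, F) ∞ (G ⧸ K)]

/-- The left-invariant metric is the one extending an inner product at `1` that makes `dπ` at `1`
isometric on the complement of its kernel. The Maurer–Cartan form matches the horizontal subspace
at `g` with the one at `1`, and invariance of `mH` carries the isometry property from `1` to `g`. -/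
theorem exists_isLeftInvariant_isRiemannianSubmersion
    (hπ : Manifold.IsSubmersion 𝓘(ℝ, E) 𝓘(ℝ, F) ∞ (QuotientGroup.mk : G → G ⧸ K))
    {mH : RiemMetric F (G ⧸ K)} (hm : IsInvariant G mH) :
    ∃ mG : RiemMetric E G, IsLeftInvariant mG ∧
      IsRiemannianSubmersion mG mH (QuotientGroup.mk : G → G ⧸ K) := by
  let p : E →L[ℝ] F := mfderiv 𝓘(ℝ, E) 𝓘(ℝ, F) (QuotientGroup.mk : G → G ⧸ K) 1
  obtain ⟨B, hs, hB, hbij, hiso⟩ := exists_inner_isometry_on_orthogonal p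
    (mfderiv_surjective_of_isSubmersion (by simp) hπ 1)
    (mH.inner (QuotientGroup.mk 1)) (mH.symm _) (mH.pos _)
  have hp : ∀ (g : G) (X : E), p (maurerCartan E g X) =
      mfderiv 𝓘(ℝ, F) 𝓘(ℝ, F) (fun q : G ⧸ K => g⁻¹ • q) (QuotientGroup.mk g)
        (mfderiv 𝓘(ℝ, E) 𝓘(ℝ, F) (QuotientGroup.mk : G → G ⧸ K) g X) :=
    fun g X => mfderiv_mk_one_maurerCartan hπ g X
  have hΦ := fun g : G => mfderiv_smul_injective hπ g⁻¹ (QuotientGroup.mk g)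
  have hhor : ∀ (g : G) (X : E),
      X ∈ horizontal F (leftInvariantMetric B hs hB : RiemMetric E G)
        (QuotientGroup.mk : G → G ⧸ K) g ↔ ∀ w, p w = 0 → B (maurerCartan E g X) w = 0 := by
    intro g X
    constructor
    · intro hX w hw
      obtain ⟨V, rfl⟩ := mfderiv_mul_left_surjective (E := E) g⁻¹ g w
      exact hX V (hΦ g (((hp g V).symm.trans hw).trans (map_zero _).symm))
    · intro hX V hV
      exact hX _ ((hp g V).trans ((congrArg _ hV).trans (map_zero _)))
  refine ⟨leftInvariantMetric B hs hB, isLeftInvariant_leftInvariantMetric B hs hB,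
    hπ.contMDiff, fun g => ⟨fun _ _ => trivial, ?_, ?_⟩, ?_⟩
  · intro X hX Y hY hXY
    refine mfderiv_mul_left_injective g⁻¹ g
      (hbij.injOn ((hhor g X).1 hX) ((hhor g Y).1 hY) ?_)
    exact (hp g X).trans ((congrArg _ hXY).trans (hp g Y).symm)
  · intro Y _
    obtain ⟨v, hv, hvY⟩ := hbij.surjOn (Set.mem_univ
      (mfderiv 𝓘(ℝ, F) 𝓘(ℝ, F) (fun q : G ⧸ K => g⁻¹ • q) (QuotientGroup.mk g) Y : F))
    obtain ⟨X, rfl⟩ := mfderiv_mul_left_surjective (E := E) g⁻¹ g v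
    exact ⟨X, (hhor g X).2 hv, hΦ g ((hp g X).symm.trans hvY)⟩
  · intro g X hX Y hY
    -- The base point `[g⁻¹ * g]` is only propositionally equal to `[1]`.
    have hbase : ∀ x : G, x = 1 →
        (mH.inner (QuotientGroup.mk x) : F →L[ℝ] F →L[ℝ] ℝ) = mH.inner (QuotientGroup.mk 1) := by
      rintro _ rfl; rfl
    have h1 := hm g⁻¹ (QuotientGroup.mk g)
      (mfderiv 𝓘(ℝ, E) 𝓘(ℝ, F) (QuotientGroup.mk : G → G ⧸ K) g X)
      (mfderiv 𝓘(ℝ, E) 𝓘(ℝ, F) (QuotientGroup.mk : G → G ⧸ K) g Y)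
    rw [← h1]
    have h2 := hiso _ ((hhor g X).1 hX) _ ((hhor g Y).1 hY)
    have h3 := congrArg₂ (fun v w : F => (mH.inner (QuotientGroup.mk 1) : F →L[ℝ] F →L[ℝ] ℝ) v w)
      (hp g X) (hp g Y)
    exact (congrArg (fun T : F →L[ℝ] F →L[ℝ] ℝ => T _ _) (hbase _ (inv_mul_cancel g))).trans
      (h3.symm.trans h2)

end Existence

end HomSpace

end

/-- `G` is a Lie group, `K` a closed subgroup, and `G ⧸ K` carries the quotient topology and its
standard smooth structure, that is, the unique one for which the canonical projection
`G → G ⧸ K` is a smooth submersion. -/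
theorem mainTheorem10
    {E : Type*} [NormedAddCommGroup E] [NormedSpace ℝ E] [FiniteDimensional ℝ E]
    {F : Type*} [NormedAddCommGroup F] [NormedSpace ℝ F] [FiniteDimensional ℝ F]
    {G : Type*} [Group G] [TopologicalSpace G] [ChartedSpace E G] [LieGroup 𝓘(ℝ, E) ∞ G]
    (K : Subgroup G) (hK : IsClosed (K : Set G))
    [ChartedSpace F (G ⧸ K)] [IsManifold 𝓘(ℝ, F) ∞ (G ⧸ K)]
    (hπ : Manifold.IsSubmersion 𝓘(ℝ, E) 𝓘(ℝ, F) ∞ (QuotientGroup.mk : G → G ⧸ K)) :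
    (∀ (mG : HomSpace.RiemMetric E G) (mH : HomSpace.RiemMetric F (G ⧸ K)),
      HomSpace.IsLeftInvariant mG →
      HomSpace.IsRiemannianSubmersion mG mH (QuotientGroup.mk : G → G ⧸ K) →
      HomSpace.IsInvariant G mH) ∧
    (∀ mH : HomSpace.RiemMetric F (G ⧸ K),
      HomSpace.IsInvariant G mH →
      ∃ mG : HomSpace.RiemMetric E G,
        HomSpace.IsLeftInvariant mG ∧
        HomSpace.IsRiemannianSubmersion mG mH (QuotientGroup.mk : G → G ⧸ K)) :=
  ⟨fun _ _ hm hsub => HomSpace.isInvariant_of_isRiemannianSubmersion hπ hm hsub,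
    fun _ hm => HomSpace.exists_isLeftInvariant_isRiemannianSubmersion hπ hm⟩
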